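/- Let $T_1=\{3214,3241,4213,4231\}$ and, for $n\ge 1$, let $S_n(T_1)$ be the set of permutations of $\{1,\dots,n\}$ that avoid all four patterns of $T_1$. For $\sigma\in S_n$ let $\mathrm{pos}(\sigma)$ be the position of the maximum symbol $n$ in $\sigma$, i.e. $\sigma(\mathrm{pos}(\sigma))=n$, and let $\mathrm{lmax}(\sigma)$ be the number of left-to-right maxima of $\sigma$, i.e. of positions $i$ with $\sigma(i)\ge\sigma(j)$ for all $j\le i$. Put $$J(x,y,w)=\sum_{n\ge1}\ \sum_{\sigma\in S_n(T_1)}x^n y^{\mathrm{pos}(\sigma)}w^{\mathrm{lmax}(\sigma)},\qquad B(x,y,w)=\sum_{n\ge1}\ \sum_{\substack{\sigma\in S_n(T_1)\\ \sigma(n)=n}}x^n y^{\mathrm{pos}(\sigma)}w^{\mathrm{lmax}(\sigma)},$$ and let $N(x,z)=\sum_{P}x^{|P|}z^{\mathrm{peak}(P)}$ be the Narayana generating function, where $P$ runs over all Dyck paths, $|P|$ is the semilength of $P$, and $\mathrm{peak}(P)$ is its number of peaks (up steps immediately followed by a down step). All of these are formal power series in $x$ with coefficients in $\mathbb{Z}[y,w]$,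 respectively $\mathbb{Z}[z]$. Then $2B(x,y,w)-yw\neq0$ and, in the respective fields of fractions of these power series rings, $$J(x,y,w)=\frac{B(x,y,w)\,\bigl(B(x,y,w)-yw\bigr)}{2B(x,y,w)-yw},$$ where $$B(x,y,w)=xyw\,N(xy,w),\qquad N(x,z)=1+\frac{1-x(1+z)-\sqrt{(1-x(1+z))^2-4x^2z}}{2x},$$ the square root being the formal power series with constant term $1$. -/

import Mathlib

namespace PermClass

/-- The permutation `σ(1) … σ(n)` contains the pattern `p(1) … p(k)` (a word in one-line
notation): some subsequence of `σ` is order isomorphic to `p`. -/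
def Contains {n k : ℕ} (σ : Equiv.Perm (Fin n)) (p : Fin k → ℕ) : Prop :=
  ∃ f : Fin k ↪o Fin n, ∀ i j, σ (f i) < σ (f j) ↔ p i < p j

/-- The set of patterns `{3214, 3241, 4213, 4231}`. -/
def T1 : Set (Fin 4 → ℕ) :=
  {![3, 2, 1, 4], ![3, 2, 4, 1], ![4, 2, 1, 3], ![4, 2, 3, 1]}

/-- `S_n(T₁)`: the permutations of length `n` that avoid every pattern of `T1`. -/
def avT1 (n : ℕ) : Set (Equiv.Perm (Fin n)) :=
  {σ | ∀ p ∈ T1, ¬ Contains σ p}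

/-- The (1-based) position of the maximum symbol. -/
def pos {n : ℕ} (σ : Equiv.Perm (Fin (n + 1))) : ℕ :=
  (σ.symm (Fin.last n) : ℕ) + 1

/-- The number of left-to-right maxima. -/
def lmax {n : ℕ} (σ : Equiv.Perm (Fin n)) : ℕ :=
  (Finset.univ.filter fun i : Fin n => ∀ j ≤ i, σ j ≤ σ i).card

/-- The ring `ℤ[y, w]`. -/
abbrev YW : Type := MvPolynomial (Fin 2) ℤ

/-- The variable `y` of `ℤ[y, w]`. -/
noncomputable def y : YW := MvPolynomial.X 0

/-- The variable `w` of `ℤ[y, w]`. -/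
noncomputable def w : YW := MvPolynomial.X 1

open Classical in
/-- The generating function `∑_{n ≥ 1} ∑_{σ ∈ A_n} x ^ n y ^ pos(σ) w ^ lmax(σ)`, as a power
series in `x` over `ℤ[y, w]`, of a family of sets `A_n` of permutations of length `n ≥ 1`. -/
noncomputable def statGF (A : ∀ n : ℕ, Set (Equiv.Perm (Fin (n + 1)))) : PowerSeries YW :=
  PowerSeries.mk fun m => match m with
    | 0 => 0
    | n + 1 => ∑ σ ∈ Finset.univ.filter (fun σ => σ ∈ A n), y ^ pos σ * w ^ lmax σ

/-- `J(x, y, w)`: the generating function of `Av(T₁)` by length, position of the maximum and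
number of left-to-right maxima. -/
noncomputable def J : PowerSeries YW :=
  statGF fun n => avT1 (n + 1)

/-- `B(x, y, w)`: the analogous generating function of the permutations in `Av(T₁)` that end with
their maximum symbol. -/
noncomputable def B : PowerSeries YW :=
  statGF fun n => {σ | σ ∈ avT1 (n + 1) ∧ σ (Fin.last n) = Fin.last n}

/-- The number of peaks of a Dyck path: occurrences of an up step immediately followed by a down
step. -/
def peaks (P : DyckWord) : ℕ :=
  (P.toList.zip P.toList.tail).count (DyckStep.U, DyckStep.D)

/-- The Narayana function `N(x, z)`: the generating function of Dyck paths by semilength and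
number of peaks, as a power series in `x` over `ℤ[z]`. -/
noncomputable def N : PowerSeries (Polynomial ℤ) :=
  PowerSeries.mk fun n =>
    ∑ P : {P : DyckWord // P.semilength = n}, (Polynomial.X : Polynomial ℤ) ^ peaks P.1

/-- `N(xy, w)`: substitute `w` for `z` in the coefficients, then `xy` for `x`. -/
noncomputable def Nxyw : PowerSeries YW :=
  PowerSeries.rescale y (PowerSeries.map (Polynomial.aeval w).toRingHom N)

/-- `S` is the square root of `F` in the ring of power series with constant term `1`. -/
def IsSqrt {R : Type*} [CommRing R] (S F : PowerSeries R) : Prop :=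
  PowerSeries.constantCoeff S = 1 ∧ S ^ 2 = F

end PermClass

namespace PermClass

/-! ### The Narayana generating function -/

/-! A permutation avoids `T1` iff each entry is a left-to-right maximum, a right-to-left maximum or
a right-to-left minimum (`mem_avT1_iff`). This makes growth by appending a last entry easy to
control: a new value only threatens entries whose right-to-left status it destroys, and those must
then be left-to-right maxima.

Up to the maximum, the word is a `321`-avoider followed by its maximum. A `321`-avoider with `r` top
values that are left-to-right maxima has children with parameters `r + 1` and `1, …, r`. With a
catalytic variable `X`, the generating function `T` of these objects is `1 / (1 - X x (N - 1 + w))`,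
so `T` at `X = 1` is `N` (`topRunGF_mul`). This gives `B`.

After the maximum, the parameters are the runs `a`, `b` of left-to-right maxima just below and just
above the last entry; a new entry splits one of them in two (`sum_avT1_succ`). Weighting by `X ^ a +
X ^ b`, each later entry acts by `F ↦ 2 (X F - F(1)) / (X - 1)`, and `T` is an eigenvector with
eigenvalue `2N` (`runsGF_eq`). Hence `m + 1` entries after the maximum contribute `2 ^ m w N ^ (m +
2)`, and a geometric series in `u = x N(xy, w)` gives `J = yw (u - u²) / (1 - 2u)`, where `B = yw
u`.

The closed form of `N` comes from the first-return decomposition, through binary trees. -/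

/-- The number of occurrences of an up step immediately followed by a down step. -/
def peaksList (l : List DyckStep) : ℕ :=
  (l.zip l.tail).count (DyckStep.U, DyckStep.D)

@[simp] lemma peaksList_cons_cons (a b : DyckStep) (l : List DyckStep) :
    peaksList (a :: b :: l) =
      peaksList (b :: l) + if a = DyckStep.U ∧ b = DyckStep.D then 1 else 0 := by
  simp [peaksList, List.count_cons]

lemma peaksList_append_of_head {l : List DyckStep} (m : List DyckStep)
    (hm : ∀ h : m ≠ [], m.head h = DyckStep.U) :
    peaksList (l ++ m) = peaksList l + peaksList m := by
  induction l with
  | nil => simp [peaksList]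
  | cons a l ih =>
    cases l with
    | nil =>
      cases m with
      | nil => simp [peaksList]
      | cons b m =>
        have hb : b = DyckStep.U := hm (by simp)
        subst hb
        simp [peaksList]
    | cons b l =>
      simp only [List.cons_append, peaksList_cons_cons] at ih ⊢
      rw [ih]
      ring

lemma peaksList_concat {l : List DyckStep} (h : l ≠ []) (hl : l.getLast h = DyckStep.D) :
    peaksList (l ++ [DyckStep.D]) = peaksList l := by
  induction l with
  | nil => exact absurd rfl h
  | cons a l ih =>
    cases l with
    | nil =>
      have ha : a = DyckStep.D := hl
      subst ha
      simp [peaksList]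
    | cons b l =>
      simp only [List.cons_append, peaksList_cons_cons] at ih ⊢
      rw [ih (by simp) (by simpa using hl)]

lemma peaks_add (P Q : DyckWord) : peaks (P + Q) = peaks P + peaks Q :=
  peaksList_append_of_head Q.toList fun h => Q.head_eq_U h

lemma peaks_nest (P : DyckWord) : peaks P.nest = if P = 0 then 1 else peaks P := by
  split_ifs with h
  · subst h
    rfl
  · have hne := DyckWord.toList_ne_nil.mpr h
    have hU := P.head_eq_U hne
    have hD := P.getLast_eq_D hne
    change peaksList ([DyckStep.U] ++ P.toList ++ [DyckStep.D]) = peaksList P.toList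
    rw [peaksList_concat (by simp) (by simpa [List.getLast_cons hne] using hD),
      peaksList_append_of_head _ fun _ => hU]
    simp [peaksList]

lemma sum_dyckWord_eq_sum_tree {M : Type*} [AddCommMonoid M] (n : ℕ) (f : DyckWord → M) :
    ∑ P : {P : DyckWord // P.semilength = n}, f P.1 =
      ∑ t ∈ BinaryTree.treesOfNumNodesEq n, f (DyckWord.equivTree.symm t) := by
  rw [← Finset.sum_coe_sort (BinaryTree.treesOfNumNodesEq n)]
  refine Fintype.sum_equiv (DyckWord.equivTreesOfNumNodesEq n) _ _ fun P => ?_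
  congr 1
  exact (DyckWord.equivTree.symm_apply_apply P.1).symm

/-- The number of peaks of the Dyck path encoded by a binary tree. -/
def treePeaks (t : BinaryTree Unit) : ℕ :=
  peaks (DyckWord.equivTree.symm t)

/-- The node is `U a D b`. Enclosing a nonempty path creates no peak, while an empty `a` leaves the
new peak `UD`. -/
lemma treePeaks_node (a b : BinaryTree Unit) :
    treePeaks (.node () a b) =
      (if a = .nil then 1 else treePeaks a) + treePeaks b := by
  have h : DyckWord.equivTree.symm (.node () a b) =
      (DyckWord.equivTree.symm a).nest + DyckWord.equivTree.symm b := rfl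
  have h0 : DyckWord.equivTree.symm a = 0 ↔ a = .nil := by
    rw [Equiv.symm_apply_eq, DyckWord.equivTree_apply, DyckWord.toTree]
    simp
  rw [treePeaks, h, peaks_add, peaks_nest]
  simp only [h0]
  rfl

lemma coeff_N (n : ℕ) : PowerSeries.coeff n N =
    ∑ t ∈ BinaryTree.treesOfNumNodesEq n, (Polynomial.X : Polynomial ℤ) ^ treePeaks t := by
  rw [N, PowerSeries.coeff_mk]
  exact sum_dyckWord_eq_sum_tree n fun P => (Polynomial.X : Polynomial ℤ) ^ peaks P

lemma constantCoeff_N : PowerSeries.constantCoeff N = 1 := by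
  rw [← PowerSeries.coeff_zero_eq_constantCoeff_apply, coeff_N,
    BinaryTree.treesOfNumNodesEq_zero, Finset.sum_singleton]
  rfl

open Finset in
lemma coeff_succ_N (n : ℕ) : PowerSeries.coeff (n + 1) N =
    PowerSeries.coeff n ((N - 1 + PowerSeries.C Polynomial.X) * N) := by
  rw [coeff_N, BinaryTree.treesOfNumNodesEq_succ, sum_biUnion, PowerSeries.coeff_mul]
  · refine sum_congr rfl fun ij _ => ?_
    have h (a b : BinaryTree Unit) :
        (Polynomial.X : Polynomial ℤ) ^ treePeaks (.node () a b) =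
          Polynomial.X ^ (if a = .nil then 1 else treePeaks a) * Polynomial.X ^ treePeaks b := by
      rw [treePeaks_node, pow_add]
    rw [sum_map, coeff_N ij.2, sum_product]
    refine (sum_congr rfl fun a _ => sum_congr rfl fun b _ => h a b).trans ?_
    rw [← sum_mul_sum]
    congr 1
    -- The empty left subtree has weight `z` instead of `1`, which is why the left factor is `N - 1
    -- + z`.
    rcases ij with ⟨_ | i, j⟩
    · simp [constantCoeff_N]
    · rw [map_add, map_sub, PowerSeries.coeff_C, PowerSeries.coeff_one, coeff_N]
      simp only [Nat.add_eq_zero_iff, one_ne_zero, and_false, if_false, sub_zero, add_zero]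
      refine sum_congr rfl fun t ht => ?_
      rw [if_neg]
      rintro rfl
      simp at ht
  · simp_rw [Set.PairwiseDisjoint, Set.Pairwise, disjoint_left]
    aesop

/-- First-return decomposition of Dyck paths. -/
lemma N_eq : N = 1 + PowerSeries.X * ((N - 1 + PowerSeries.C Polynomial.X) * N) := by
  ext1 n
  cases n with
  | zero =>
    rw [PowerSeries.coeff_zero_eq_constantCoeff_apply, constantCoeff_N, map_add,
      PowerSeries.coeff_zero_X_mul, PowerSeries.coeff_zero_one, add_zero]
  | succ n => simp [coeff_succ_N, PowerSeries.coeff_succ_X_mul, PowerSeries.coeff_one]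

/-- The closed form of the Narayana function. -/
lemma exists_isSqrt_N : ∃ S : PowerSeries (Polynomial ℤ),
    IsSqrt S
      ((1 - PowerSeries.X * (1 + PowerSeries.C Polynomial.X)) ^ 2 -
        4 * PowerSeries.X ^ 2 * PowerSeries.C Polynomial.X) ∧
    algebraMap (PowerSeries (Polynomial ℤ)) (FractionRing (PowerSeries (Polynomial ℤ))) N =
      1 + algebraMap (PowerSeries (Polynomial ℤ)) (FractionRing (PowerSeries (Polynomial ℤ)))
            (1 - PowerSeries.X * (1 + PowerSeries.C Polynomial.X) - S) /
          algebraMap (PowerSeries (Polynomial ℤ)) (FractionRing (PowerSeries (Polynomial ℤ)))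
            (2 * PowerSeries.X) := by
  -- The witness is the claimed formula solved for the root; its square is then right because `N`
  -- satisfies a quadratic equation.
  refine ⟨1 - PowerSeries.X * (1 + PowerSeries.C Polynomial.X) - 2 * PowerSeries.X * (N - 1),
    ⟨by simp, ?_⟩, ?_⟩
  · linear_combination (-4 * PowerSeries.X) * N_eq
  · have h2 : (2 * PowerSeries.X : PowerSeries (Polynomial ℤ)) ≠ 0 :=
      mul_ne_zero (fun h => two_ne_zero (α := Polynomial ℤ) <| by
        simpa only [map_ofNat, map_zero] using congrArg PowerSeries.constantCoeff h)
        PowerSeries.X_ne_zero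
    have h2' := (map_ne_zero_iff (algebraMap (PowerSeries (Polynomial ℤ))
      (FractionRing (PowerSeries (Polynomial ℤ)))) (IsFractionRing.injective _ _)).mpr h2
    rw [sub_sub_cancel, map_mul _ _ (N - 1), mul_div_cancel_left₀ _ h2', map_sub, map_one]
    ring

/-! ### Permutations avoiding `T1` through extremal positions -/

/-- `i` is the position of a left-to-right maximum. -/
def IsLRMax {n : ℕ} (σ : Equiv.Perm (Fin n)) (i : Fin n) : Prop := ∀ j < i, σ j < σ i

/-- `i` is the position of a right-to-left maximum. -/
def IsRLMax {n : ℕ} (σ : Equiv.Perm (Fin n)) (i : Fin n) : Prop := ∀ j, i < j → σ j < σ i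

/-- `i` is the position of a right-to-left minimum. -/
def IsRLMin {n : ℕ} (σ : Equiv.Perm (Fin n)) (i : Fin n) : Prop := ∀ j, i < j → σ i < σ j

lemma contains_of_lt {n : ℕ} (σ : Equiv.Perm (Fin n)) (p : Fin 4 → ℕ) {a b c d : Fin n}
    (hab : a < b) (hbc : b < c) (hcd : c < d)
    (h : ∀ i j, σ (![a, b, c, d] i) < σ (![a, b, c, d] j) ↔ p i < p j) : Contains σ p := by
  refine ⟨OrderEmbedding.ofStrictMono ![a, b, c, d] ?_, h⟩
  rw [Fin.strictMono_iff_lt_succ]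
  intro i
  fin_cases i <;> simp [hab, hbc, hcd]

/-- In each pattern the second letter `2` follows a larger letter and precedes both a smaller and a
larger one. The four patterns are the possible orders of those last two positions and of the two
larger values. -/
lemma mem_avT1_iff {n : ℕ} (σ : Equiv.Perm (Fin n)) :
    σ ∈ avT1 n ↔ ∀ i, IsLRMax σ i ∨ IsRLMax σ i ∨ IsRLMin σ i := by
  constructor
  · intro h i
    by_contra hi
    simp only [IsLRMax, IsRLMax, IsRLMin] at hi
    push Not at hi
    obtain ⟨⟨b, hbi, hb⟩, ⟨c, hci, hc⟩, ⟨z, hzi, hz⟩⟩ := hi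
    have hb := lt_of_le_of_ne hb (σ.injective.ne hbi.ne')
    have hc := lt_of_le_of_ne hc (σ.injective.ne hci.ne)
    have hz := lt_of_le_of_ne hz (σ.injective.ne hzi.ne')
    have hcz : c ≠ z := by
      rintro rfl
      exact lt_asymm hc hz
    have hbc : σ b ≠ σ c := σ.injective.ne (hbi.trans hci).ne
    rcases lt_or_gt_of_ne hcz with hcz | hcz <;> rcases lt_or_gt_of_ne hbc with hbc | hbc
    · refine h ![3, 2, 4, 1] (by simp [T1]) (contains_of_lt σ _ hbi hci hcz ?_)
      simp [Fin.forall_fin_succ]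
      omega
    · refine h ![4, 2, 3, 1] (by simp [T1]) (contains_of_lt σ _ hbi hci hcz ?_)
      simp [Fin.forall_fin_succ]
      omega
    · refine h ![3, 2, 1, 4] (by simp [T1]) (contains_of_lt σ _ hbi hzi hcz ?_)
      simp [Fin.forall_fin_succ]
      omega
    · refine h ![4, 2, 1, 3] (by simp [T1]) (contains_of_lt σ _ hbi hzi hcz ?_)
      simp [Fin.forall_fin_succ]
      omega
  · rintro h p hp ⟨f, hf⟩
    have h01 : f 0 < f 1 := f.strictMono (by decide)
    have h12 : f 1 < f 2 := f.strictMono (by decide)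
    have h13 : f 1 < f 3 := f.strictMono (by decide)
    have k10 := hf 1 0
    have k12 := hf 1 2
    have k21 := hf 2 1
    have k13 := hf 1 3
    have k31 := hf 3 1
    have hp' : p 1 < p 0 ∧ (p 1 < p 2 ∧ p 3 < p 1 ∨ p 1 < p 3 ∧ p 2 < p 1) := by
      simp only [T1, Set.mem_insert_iff, Set.mem_singleton_iff] at hp
      rcases hp with rfl | rfl | rfl | rfl <;> simp
    rw [← k10, ← k12, ← k21, ← k13, ← k31] at hp'
    rcases h (f 1) with h1 | h1 | h1
    · exact lt_asymm hp'.1 (h1 _ h01)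
    · have := h1 _ h12
      have := h1 _ h13
      omega
    · have := h1 _ h12
      have := h1 _ h13
      omega

/-! ### Appending a last element -/

/-- The permutation of length `n + 1` which ends with `v` and whose other entries are in the same
relative order as those of `σ`. -/
def append {n : ℕ} (σ : Equiv.Perm (Fin n)) (v : Fin (n + 1)) : Equiv.Perm (Fin (n + 1)) :=
  (finSuccEquiv' (Fin.last n)).trans ((Equiv.optionCongr σ).trans (finSuccEquiv' v).symm)

@[simp] lemma append_last {n : ℕ} (σ : Equiv.Perm (Fin n)) (v : Fin (n + 1)) :
    append σ v (Fin.last n) = v := by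
  simp [append]

@[simp] lemma append_castSucc {n : ℕ} (σ : Equiv.Perm (Fin n)) (v : Fin (n + 1)) (i : Fin n) :
    append σ v i.castSucc = v.succAbove (σ i) := by
  simp [append, finSuccEquiv'_last_apply_castSucc]

lemma append_bijective (n : ℕ) : Function.Bijective
    fun p : Equiv.Perm (Fin n) × Fin (n + 1) => append p.1 p.2 := by
  rw [Fintype.bijective_iff_injective_and_card]
  refine ⟨fun p q h => ?_, by simp [Fintype.card_perm, Nat.factorial_succ, mul_comm]⟩
  have h2 : p.2 = q.2 := by simpa using DFunLike.congr_fun h (Fin.last n)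
  refine Prod.ext (Equiv.ext fun i => ?_) h2
  have := DFunLike.congr_fun h i.castSucc
  simp only [append_castSucc, h2] at this
  exact Fin.succAbove_right_injective this

lemma sum_perm_succ {M : Type*} [AddCommMonoid M] (n : ℕ) (f : Equiv.Perm (Fin (n + 1)) → M) :
    ∑ σ, f σ = ∑ σ : Equiv.Perm (Fin n), ∑ v : Fin (n + 1), f (append σ v) := by
  rw [← Fintype.sum_prod_type']
  exact (Function.Bijective.sum_comp (append_bijective n) f).symm

lemma isLRMax_append_castSucc {n : ℕ} (σ : Equiv.Perm (Fin n)) (v : Fin (n + 1)) (i : Fin n) :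
    IsLRMax (append σ v) i.castSucc ↔ IsLRMax σ i := by
  simp [IsLRMax, Fin.forall_fin_succ', (Fin.castSucc_lt_last i).not_gt]

lemma isLRMax_append_last {n : ℕ} (σ : Equiv.Perm (Fin n)) (v : Fin (n + 1)) :
    IsLRMax (append σ v) (Fin.last n) ↔ v = Fin.last n := by
  constructor
  · intro h
    by_contra hv
    obtain ⟨u, hu⟩ := Fin.exists_succAbove_eq (Ne.symm hv)
    have := h (σ.symm u).castSucc (Fin.castSucc_lt_last _)
    rw [append_castSucc, append_last, Equiv.apply_symm_apply, hu] at this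
    exact absurd this (Fin.le_last v).not_gt
  · rintro rfl j hj
    obtain ⟨j, rfl⟩ := Fin.exists_castSucc_eq.2 hj.ne
    simp [Fin.castSucc_lt_last]

lemma isRLMax_append_castSucc {n : ℕ} (σ : Equiv.Perm (Fin n)) (v : Fin (n + 1)) (i : Fin n) :
    IsRLMax (append σ v) i.castSucc ↔ IsRLMax σ i ∧ (v : ℕ) ≤ σ i := by
  change _ ↔ IsRLMax σ i ∧ v ≤ (σ i).castSucc
  simp [IsRLMax, Fin.forall_fin_succ', Fin.castSucc_lt_last, Fin.lt_succAbove_iff_le_castSucc]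

lemma isRLMin_append_castSucc {n : ℕ} (σ : Equiv.Perm (Fin n)) (v : Fin (n + 1)) (i : Fin n) :
    IsRLMin (append σ v) i.castSucc ↔ IsRLMin σ i ∧ (σ i : ℕ) < v := by
  change _ ↔ IsRLMin σ i ∧ (σ i).castSucc < v
  simp [IsRLMin, Fin.forall_fin_succ', Fin.castSucc_lt_last, Fin.succAbove_lt_iff_castSucc_lt]

lemma isRLMax_last {n : ℕ} (σ : Equiv.Perm (Fin (n + 1))) : IsRLMax σ (Fin.last n) :=
  fun j hj => absurd hj (Fin.le_last j).not_gt

lemma isRLMin_last {n : ℕ} (σ : Equiv.Perm (Fin (n + 1))) : IsRLMin σ (Fin.last n) :=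
  fun j hj => absurd hj (Fin.le_last j).not_gt

/-- Every entry is a left-to-right maximum or a right-to-left minimum; equivalently, `σ` avoids
`321`. -/
def Avoids321 {n : ℕ} (σ : Equiv.Perm (Fin n)) : Prop := ∀ i, IsLRMax σ i ∨ IsRLMin σ i

/-- The new entry is itself a right-to-left maximum, so only the old entries impose conditions. -/
lemma append_mem_avT1_iff {n : ℕ} (σ : Equiv.Perm (Fin n)) (v : Fin (n + 1)) :
    append σ v ∈ avT1 (n + 1) ↔ ∀ i, IsLRMax σ i ∨ (IsRLMax σ i ∧ (v : ℕ) ≤ σ i) ∨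
      (IsRLMin σ i ∧ (σ i : ℕ) < v) := by
  simp [mem_avT1_iff, Fin.forall_fin_succ', isLRMax_append_castSucc, isRLMax_append_castSucc,
    isRLMin_append_castSucc, isRLMax_last]

lemma append_last_mem_avT1_iff {n : ℕ} (σ : Equiv.Perm (Fin n)) :
    append σ (Fin.last n) ∈ avT1 (n + 1) ↔ Avoids321 σ := by
  rw [append_mem_avT1_iff]
  refine forall_congr' fun i => ?_
  simp [(σ i).2, (σ i).2.not_ge]

lemma avoids321_append_iff {n : ℕ} (σ : Equiv.Perm (Fin n)) (v : Fin (n + 1)) :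
    Avoids321 (append σ v) ↔ ∀ i, IsLRMax σ i ∨ (IsRLMin σ i ∧ (σ i : ℕ) < v) := by
  simp [Avoids321, Fin.forall_fin_succ', isLRMax_append_castSucc,
    isRLMin_append_castSucc, isRLMin_last]

lemma lmax_eq_sum {n : ℕ} (σ : Equiv.Perm (Fin n)) [DecidablePred (IsLRMax σ)] :
    lmax σ = ∑ i, if IsLRMax σ i then 1 else 0 := by
  rw [lmax, ← Finset.card_filter]
  congr 1
  refine Finset.filter_congr fun i _ =>
    ⟨fun h j hj => lt_of_le_of_ne (h j hj.le) (σ.injective.ne hj.ne), fun h j hj => ?_⟩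
  rcases hj.eq_or_lt with rfl | hj
  · rfl
  · exact (h j hj).le

open Classical in
lemma lmax_append {n : ℕ} (σ : Equiv.Perm (Fin n)) (v : Fin (n + 1)) :
    lmax (append σ v) = lmax σ + if v = Fin.last n then 1 else 0 := by
  simp only [lmax_eq_sum, Fin.sum_univ_castSucc, isLRMax_append_castSucc, isLRMax_append_last]

lemma pos_append_last {n : ℕ} (σ : Equiv.Perm (Fin n)) : pos (append σ (Fin.last n)) = n + 1 := by
  have : (append σ (Fin.last n)).symm (Fin.last n) = Fin.last n := by
    rw [Equiv.symm_apply_eq, append_last]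
  simp [pos, this]

lemma pos_append_of_ne {n : ℕ} (σ : Equiv.Perm (Fin (n + 1))) {v : Fin (n + 2)}
    (hv : v ≠ Fin.last (n + 1)) : pos (append σ v) = pos σ := by
  have : (append σ v).symm (Fin.last (n + 1)) = (σ.symm (Fin.last n)).castSucc := by
    rw [Equiv.symm_apply_eq, append_castSucc, Equiv.apply_symm_apply,
      Fin.succAbove_ne_last_last hv]
  simp [pos, this]

/-! ### Runs of left-to-right maxima -/

/-- The value `c` is a left-to-right maximum of `σ`. -/
def IsLRMaxValue {n : ℕ} (σ : Equiv.Perm (Fin n)) (c : ℕ) : Prop :=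
  ∃ i, (σ i : ℕ) = c ∧ IsLRMax σ i

lemma isLRMaxValue_apply {n : ℕ} (σ : Equiv.Perm (Fin n)) (i : Fin n) :
    IsLRMaxValue σ (σ i) ↔ IsLRMax σ i := by
  refine ⟨?_, fun h => ⟨i, rfl, h⟩⟩
  rintro ⟨j, hj, h⟩
  rwa [σ.injective (Fin.ext hj)] at h

lemma isLRMaxValue_append_lt {n : ℕ} (σ : Equiv.Perm (Fin n)) (v : Fin (n + 1)) {c : ℕ}
    (hc : c < v) : IsLRMaxValue (append σ v) c ↔ IsLRMaxValue σ c := by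
  have hcn : c < n := by omega
  obtain ⟨i, hi⟩ := σ.surjective ⟨c, hcn⟩
  have h1 : c = (σ i : ℕ) := by simp [hi]
  have h2 : c = (append σ v i.castSucc : ℕ) := by
    rw [append_castSucc, Fin.succAbove_of_castSucc_lt _ _ (by simp [Fin.lt_def, ← h1, hc])]
    simp [← h1]
  conv_lhs => rw [h2]
  rw [h1, isLRMaxValue_apply, isLRMaxValue_apply, isLRMax_append_castSucc]

lemma isLRMaxValue_append_gt {n : ℕ} (σ : Equiv.Perm (Fin n)) (v : Fin (n + 1)) {c : ℕ}
    (hc : v ≤ c) (hcn : c < n) : IsLRMaxValue (append σ v) (c + 1) ↔ IsLRMaxValue σ c := by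
  obtain ⟨i, hi⟩ := σ.surjective ⟨c, hcn⟩
  have h1 : c = (σ i : ℕ) := by simp [hi]
  have h2 : c + 1 = (append σ v i.castSucc : ℕ) := by
    rw [append_castSucc, Fin.succAbove_of_le_castSucc _ _ (by simp [Fin.le_def, ← h1, hc])]
    simp [← h1]
  rw [h2, h1, isLRMaxValue_apply, isLRMaxValue_apply, isLRMax_append_castSucc]

lemma isLRMaxValue_append_self {n : ℕ} (σ : Equiv.Perm (Fin n)) (v : Fin (n + 1)) :
    IsLRMaxValue (append σ v) v ↔ v = Fin.last n := by
  rw [← isLRMax_append_last σ v, ← isLRMaxValue_apply, append_last]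

/-- The maximum stands earlier. Hence the value of the last entry interrupts every run that reaches
it. -/
lemma not_isLRMaxValue_apply_last {n : ℕ} (σ : Equiv.Perm (Fin (n + 1)))
    (h : σ (Fin.last n) ≠ Fin.last n) : ¬ IsLRMaxValue σ (σ (Fin.last n)) := by
  rw [isLRMaxValue_apply]
  intro hl
  have hne : σ.symm (Fin.last n) ≠ Fin.last n := by
    rwa [Ne, Equiv.symm_apply_eq, eq_comm]
  have := hl _ (lt_of_le_of_ne (Fin.le_last _) hne)
  rw [Equiv.apply_symm_apply] at this
  exact absurd this (Fin.le_last _).not_gt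

open Classical in
/-- The number of consecutive values just below `t` that satisfy `p`. -/
noncomputable def downRun (p : ℕ → Prop) : ℕ → ℕ
  | 0 => 0
  | t + 1 => if p t then downRun p t + 1 else 0

open Classical in
/-- The number of consecutive values from `t` upwards that satisfy `p`, among the `d` first. -/
noncomputable def upRun (p : ℕ → Prop) (t : ℕ) : ℕ → ℕ
  | 0 => 0
  | d + 1 => if p t then upRun p (t + 1) d + 1 else 0

lemma downRun_le (p : ℕ → Prop) (t : ℕ) : downRun p t ≤ t := by
  induction t with
  | zero => simp [downRun]
  | succ t ih =>
    rw [downRun]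
    split_ifs <;> omega

lemma downRun_add {p : ℕ → Prop} {t : ℕ} (j : ℕ) (h : ∀ c, t ≤ c → c < t + j → p c) :
    downRun p (t + j) = downRun p t + j := by
  induction j with
  | zero => rfl
  | succ j ih =>
    rw [← add_assoc, downRun, if_pos (h _ (by omega) (by omega)),
      ih fun c h1 h2 => h c h1 (by omega)]
    omega

lemma le_downRun_iff {p : ℕ → Prop} {t j : ℕ} (hj : j ≤ t) :
    j ≤ downRun p t ↔ ∀ c, t - j ≤ c → c < t → p c := by
  induction t generalizing j with
  | zero => simp; omega
  | succ t ih =>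
    cases j with
    | zero => simp; omega
    | succ j =>
      rw [downRun]
      split_ifs with h
      · rw [Nat.add_le_add_iff_right, ih (by omega)]
        refine ⟨fun H c h1 h2 => ?_, fun H c h1 h2 => H c (by omega) (by omega)⟩
        rcases Nat.lt_succ_iff_lt_or_eq.mp h2 with h2 | rfl
        · exact H c (by omega) h2
        · exact h
      · simp only [nonpos_iff_eq_zero, Nat.add_eq_zero_iff, one_ne_zero, and_false, false_iff]
        exact fun H => h (H t (by omega) (by omega))

open Classical in
lemma downRun_congr {p q : ℕ → Prop} {t : ℕ} (h : ∀ c < t, (p c ↔ q c)) :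
    downRun p t = downRun q t := by
  induction t with
  | zero => rfl
  | succ t ih =>
    have ht := h t (by omega)
    rw [downRun, downRun, ih fun c hc => h c (by omega)]
    exact if_congr ht rfl rfl

lemma upRun_le (p : ℕ → Prop) (t d : ℕ) : upRun p t d ≤ d := by
  induction d generalizing t with
  | zero => simp [upRun]
  | succ d ih =>
    have := ih (t + 1)
    rw [upRun]
    split_ifs <;> omega

lemma upRun_add {p : ℕ → Prop} {t : ℕ} (j d : ℕ) (h : ∀ c, t ≤ c → c < t + j → p c) :
    upRun p t (j + d) = j + upRun p (t + j) d := by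
  induction j generalizing t with
  | zero => simp
  | succ j ih =>
    rw [show j + 1 + d = j + d + 1 by omega, upRun, if_pos (h _ (by omega) (by omega)),
      ih fun c h1 h2 => h c (by omega) (by omega), show t + 1 + j = t + (j + 1) by omega]
    omega

lemma le_upRun_iff {p : ℕ → Prop} {t d j : ℕ} (hj : j ≤ d) :
    j ≤ upRun p t d ↔ ∀ c, t ≤ c → c < t + j → p c := by
  induction d generalizing t j with
  | zero =>
    obtain rfl : j = 0 := by omega
    simp only [zero_le, add_zero, true_iff]
    omega
  | succ d ih =>
    cases j with
    | zero =>
      simp only [zero_le, add_zero, true_iff]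
      omega
    | succ j =>
      rw [upRun]
      split_ifs with h
      · rw [Nat.add_le_add_iff_right, ih (by omega)]
        refine ⟨fun H c h1 h2 => ?_, fun H c h1 h2 => H c (by omega) (by omega)⟩
        rcases h1.eq_or_lt with rfl | h1
        · exact h
        · exact H c (by omega) (by omega)
      · simp only [nonpos_iff_eq_zero, Nat.add_eq_zero_iff, one_ne_zero, and_false, false_iff]
        exact fun H => h (H t (by omega) (by omega))

open Classical in
lemma upRun_congr {p q : ℕ → Prop} {t s d : ℕ} (h : ∀ c < d, (p (t + c) ↔ q (s + c))) :
    upRun p t d = upRun q s d := by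
  induction d generalizing t s with
  | zero => rfl
  | succ d ih =>
    have h0 := h 0 (by omega)
    simp only [add_zero] at h0
    have h1 : upRun p (t + 1) d = upRun q (s + 1) d := ih fun c hc => by
      simpa only [add_assoc, add_comm 1 c] using h (c + 1) (by omega)
    rw [upRun, upRun, h1]
    exact if_congr h0 rfl rfl

/-! ### Growth of `321`-avoiding permutations -/

lemma sum_range_ite_lt {M : Type*} [AddCommMonoid M] (f : ℕ → M) {r m : ℕ} (h : r ≤ m) :
    (∑ j ∈ Finset.range m, if j < r then f j else 0) = ∑ j ∈ Finset.range r, f j := by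
  rw [← Finset.sum_filter]
  congr 1
  ext j
  simp only [Finset.mem_filter, Finset.mem_range]
  omega

/-- The number of consecutive largest values that are left-to-right maxima. -/
noncomputable def topRun {n : ℕ} (σ : Equiv.Perm (Fin n)) : ℕ :=
  downRun (IsLRMaxValue σ) n

lemma topRun_append_last {n : ℕ} (σ : Equiv.Perm (Fin n)) :
    topRun (append σ (Fin.last n)) = topRun σ + 1 := by
  rw [topRun, downRun, if_pos, topRun,
    downRun_congr (t := n) fun c hc => isLRMaxValue_append_lt σ (Fin.last n) hc]
  simpa using (isLRMaxValue_append_self σ (Fin.last n)).mpr rfl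

/-- The values above `v` are the old values from `v` on, shifted by one, all left-to-right maxima;
`v` itself is not one and stops the run. -/
lemma topRun_append {n : ℕ} (σ : Equiv.Perm (Fin n)) {v : Fin (n + 1)} (hv : v ≠ Fin.last n)
    (h : n - v ≤ topRun σ) : topRun (append σ v) = n - v := by
  have hvn : (v : ℕ) < n := Fin.val_lt_last hv
  rw [topRun, le_downRun_iff (by omega)] at h
  have h0 : downRun (IsLRMaxValue (append σ v)) (v + 1) = 0 := by
    rw [downRun, if_neg]
    rwa [isLRMaxValue_append_self]
  have := downRun_add (p := IsLRMaxValue (append σ v)) (t := v + 1) (n - v) fun c h1 h2 => by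
    obtain ⟨c, rfl⟩ : ∃ d, c = d + 1 := ⟨c - 1, by omega⟩
    rw [isLRMaxValue_append_gt σ v (by omega) (by omega)]
    exact h c (by omega) (by omega)
  rw [h0, zero_add, show (v : ℕ) + 1 + (n - v) = n + 1 by omega] at this
  exact this

/-- Old values at least `v` cease to be right-to-left minima, so all of them must be left-to-right
maxima. -/
lemma avoids321_append_iff_le_topRun {n : ℕ} (σ : Equiv.Perm (Fin n)) (v : Fin (n + 1)) :
    Avoids321 (append σ v) ↔ Avoids321 σ ∧ n - v ≤ topRun σ := by
  rw [avoids321_append_iff, topRun, le_downRun_iff (by omega)]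
  constructor
  · refine fun h => ⟨fun i => (h i).imp_right And.left, fun c h1 h2 => ?_⟩
    obtain ⟨i, hi⟩ := σ.surjective ⟨c, h2⟩
    have hc : c = (σ i : ℕ) := by simp [hi]
    rw [hc, isLRMaxValue_apply]
    exact (h i).resolve_right fun h => by omega
  · rintro ⟨h, hl⟩ i
    by_cases hi : (σ i : ℕ) < v
    · exact (h i).imp_right fun h => ⟨h, hi⟩
    · exact Or.inl ((isLRMaxValue_apply σ i).mp (hl _ (by omega) (σ i).2))

open Classical in
lemma sum_avoids321_succ {M : Type*} [AddCommMonoid M] (n : ℕ) (φ : ℕ → ℕ → M) :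
    (∑ σ : Equiv.Perm (Fin (n + 1)), if Avoids321 σ then φ (lmax σ) (topRun σ) else 0) =
      ∑ σ : Equiv.Perm (Fin n), if Avoids321 σ then
        φ (lmax σ + 1) (topRun σ + 1) + ∑ j ∈ Finset.range (topRun σ), φ (lmax σ) (j + 1)
        else 0 := by
  rw [sum_perm_succ]
  refine Finset.sum_congr rfl fun σ _ => ?_
  rw [Fin.sum_univ_castSucc, add_comm]
  simp only [avoids321_append_iff_le_topRun, lmax_append, topRun_append_last]
  by_cases hσ : Avoids321 σ
  · simp only [hσ, true_and, if_true, Fin.val_last, Nat.sub_self, zero_le]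
    congr 1
    rw [← sum_range_ite_lt _ (show topRun σ ≤ n from downRun_le _ n),
      ← Fin.sum_univ_eq_sum_range (fun j => if j < topRun σ then φ (lmax σ) (j + 1) else 0) n,
      -- Reversal indexes the non-maximal choices by `j = n - 1 - v`, so that the new run has length
      -- `n - v = j + 1`.
      ← Equiv.sum_comp Fin.revPerm]
    refine Finset.sum_congr rfl fun v _ => ?_
    have hv : n - ((Fin.revPerm v).castSucc : ℕ) = v + 1 := by
      simp
      omega
    rw [hv]
    refine if_ctx_congr Iff.rfl (fun h => ?_) fun _ => rfl
    rw [topRun_append σ (Fin.castSucc_lt_last _).ne (by rwa [hv]), hv,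
      if_neg (Fin.castSucc_lt_last _).ne, add_zero]
  · simp [hσ]

/-! ### Growth of `T1`-avoiding permutations -/

/-- The number of consecutive values just below the last entry that are left-to-right maxima. -/
noncomputable def runBelow {n : ℕ} (σ : Equiv.Perm (Fin (n + 1))) : ℕ :=
  downRun (IsLRMaxValue σ) (σ (Fin.last n))

/-- The number of consecutive values just above the last entry that are left-to-right maxima,
not counting the largest value. -/
noncomputable def runAbove {n : ℕ} (σ : Equiv.Perm (Fin (n + 1))) : ℕ :=
  upRun (IsLRMaxValue σ) ((σ (Fin.last n) : ℕ) + 1) (n - ((σ (Fin.last n) : ℕ) + 1))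

/-- Only values strictly between the old last entry and the new one are at risk: the old entry
already denies them one right-to-left status and the new entry takes away the other. -/
lemma append_mem_avT1_iff_runs {n : ℕ} (σ : Equiv.Perm (Fin (n + 1))) (v : Fin (n + 2)) :
    append σ v ∈ avT1 (n + 2) ↔ σ ∈ avT1 (n + 1) ∧
      (∀ c : ℕ, v ≤ c → c < σ (Fin.last n) → IsLRMaxValue σ c) ∧
      ∀ c, (σ (Fin.last n) : ℕ) < c → c < v → IsLRMaxValue σ c := by
  rw [append_mem_avT1_iff]
  constructor
  · intro h
    refine ⟨(mem_avT1_iff σ).mpr fun i => (h i).imp_right (Or.imp And.left And.left),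
      fun c h1 h2 => ?_, fun c h1 h2 => ?_⟩
    all_goals
      obtain ⟨i, hi⟩ := σ.surjective ⟨c, by omega⟩
      have hc : c = (σ i : ℕ) := by simp [hi]
      have hil : i < Fin.last n := lt_of_le_of_ne (Fin.le_last i) (by rintro rfl; omega)
      rw [hc, isLRMaxValue_apply]
      rcases h i with h | h | h
      · exact h
      · have := h.1 _ hil
        omega
      · have := h.1 _ hil
        omega
  · rintro ⟨h, hb, ha⟩ i
    rw [← isLRMaxValue_apply]
    have hL := isLRMaxValue_apply σ i
    by_cases hil : i = Fin.last n
    · subst hil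
      by_cases hv : (v : ℕ) ≤ σ (Fin.last n)
      · exact Or.inr (Or.inl ⟨isRLMax_last σ, hv⟩)
      · exact Or.inr (Or.inr ⟨isRLMin_last σ, not_le.mp hv⟩)
    · have hil := lt_of_le_of_ne (Fin.le_last i) hil
      rcases (mem_avT1_iff σ).mp h i with h | h | h
      · exact Or.inl (hL.mpr h)
      · have h1 : (σ (Fin.last n) : ℕ) < σ i := h _ hil
        by_cases hv : (v : ℕ) ≤ σ i
        · exact Or.inr (Or.inl ⟨h, hv⟩)
        · exact Or.inl (ha (σ i) h1 (by omega))
      · have h1 : (σ i : ℕ) < σ (Fin.last n) := h _ hil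
        by_cases hv : (v : ℕ) ≤ σ i
        · exact Or.inl (hb (σ i) hv h1)
        · exact Or.inr (Or.inr ⟨h, by omega⟩)

lemma append_mem_avT1_iff_of_le {n : ℕ} (σ : Equiv.Perm (Fin (n + 1))) {v : Fin (n + 2)}
    (hv : (v : ℕ) ≤ σ (Fin.last n)) :
    append σ v ∈ avT1 (n + 2) ↔ σ ∈ avT1 (n + 1) ∧ (σ (Fin.last n) : ℕ) - v ≤ runBelow σ := by
  rw [append_mem_avT1_iff_runs, runBelow, le_downRun_iff (by omega), Nat.sub_sub_self hv]
  exact and_congr_right fun _ => and_iff_left fun c h1 h2 => by omega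

lemma append_mem_avT1_iff_of_gt {n : ℕ} (σ : Equiv.Perm (Fin (n + 1))) {v : Fin (n + 2)}
    (hv : (σ (Fin.last n) : ℕ) < v) (hvn : v ≠ Fin.last (n + 1)) :
    append σ v ∈ avT1 (n + 2) ↔
      σ ∈ avT1 (n + 1) ∧ (v : ℕ) - ((σ (Fin.last n) : ℕ) + 1) ≤ runAbove σ := by
  have hvn : (v : ℕ) < n + 1 := Fin.val_lt_last hvn
  rw [append_mem_avT1_iff_runs, runAbove, le_upRun_iff (by omega), Nat.add_sub_cancel' hv]
  exact and_congr_right fun _ => and_iff_right fun c h1 h2 => by omega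

lemma runBelow_append_of_le {n : ℕ} (σ : Equiv.Perm (Fin (n + 1))) {v : Fin (n + 2)}
    (hv : (v : ℕ) ≤ σ (Fin.last n)) (h : (σ (Fin.last n) : ℕ) - v ≤ runBelow σ) :
    runBelow (append σ v) = runBelow σ - ((σ (Fin.last n) : ℕ) - v) := by
  rw [runBelow, le_downRun_iff (by omega), Nat.sub_sub_self hv] at h
  have := downRun_add (p := IsLRMaxValue σ) (t := v) ((σ (Fin.last n) : ℕ) - v)
    fun c h1 h2 => h c h1 (by omega)
  rw [Nat.add_sub_cancel' hv] at this
  rw [runBelow, append_last, downRun_congr fun c hc => isLRMaxValue_append_lt σ v hc, runBelow,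
    this, Nat.add_sub_cancel]

lemma runAbove_append_of_le {n : ℕ} (σ : Equiv.Perm (Fin (n + 1))) {v : Fin (n + 2)}
    (hv : (v : ℕ) ≤ σ (Fin.last n)) (h : (σ (Fin.last n) : ℕ) - v ≤ runBelow σ) :
    runAbove (append σ v) = (σ (Fin.last n) : ℕ) - v := by
  have hen : (σ (Fin.last n) : ℕ) ≤ n := Fin.is_le _
  rw [runBelow, le_downRun_iff (by omega), Nat.sub_sub_self hv] at h
  -- The old last entry ends the new upper run. If it is the maximum, the run ends there anyway,
  -- since the largest value is not counted.
  have h0 : upRun (IsLRMaxValue σ) (σ (Fin.last n)) (n - (σ (Fin.last n) : ℕ)) = 0 := by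
    rcases hen.eq_or_lt with he | he
    · rw [he, Nat.sub_self, upRun]
    · obtain ⟨d, hd⟩ : ∃ d, n - (σ (Fin.last n) : ℕ) = d + 1 :=
        ⟨n - (σ (Fin.last n) : ℕ) - 1, by omega⟩
      rw [hd, upRun, if_neg]
      exact not_isLRMaxValue_apply_last σ fun h => by simp [h] at he
  have := upRun_add (p := IsLRMaxValue σ) (t := v) ((σ (Fin.last n) : ℕ) - v)
    (n - (σ (Fin.last n) : ℕ))
    fun c h1 h2 => h c h1 (by omega)
  rw [Nat.add_sub_cancel' hv, h0, add_zero] at this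
  rw [runAbove, append_last, upRun_congr (s := v) (q := IsLRMaxValue σ) fun c hc => by
    rw [add_right_comm (v : ℕ) 1 c]
    exact isLRMaxValue_append_gt σ v (by omega) (by omega), ← this]
  congr 1
  omega

lemma runBelow_append_of_gt {n : ℕ} (σ : Equiv.Perm (Fin (n + 1))) {v : Fin (n + 2)}
    (hv : (σ (Fin.last n) : ℕ) < v) (hvn : v ≠ Fin.last (n + 1))
    (h : (v : ℕ) - ((σ (Fin.last n) : ℕ) + 1) ≤ runAbove σ) :
    runBelow (append σ v) = (v : ℕ) - ((σ (Fin.last n) : ℕ) + 1) := by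
  have hvn : (v : ℕ) < n + 1 := Fin.val_lt_last hvn
  rw [runAbove, le_upRun_iff (by omega), Nat.add_sub_cancel' hv] at h
  have h0 : downRun (IsLRMaxValue σ) ((σ (Fin.last n) : ℕ) + 1) = 0 := by
    rw [downRun, if_neg]
    exact not_isLRMaxValue_apply_last σ fun h => by simp [h] at hv; omega
  have := downRun_add (p := IsLRMaxValue σ) (t := (σ (Fin.last n) : ℕ) + 1)
    ((v : ℕ) - ((σ (Fin.last n) : ℕ) + 1)) fun c h1 h2 => h c h1 (by omega)
  rw [Nat.add_sub_cancel' hv, h0, zero_add] at this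
  rw [runBelow, append_last, downRun_congr fun c hc => isLRMaxValue_append_lt σ v hc, this]

lemma runAbove_append_of_gt {n : ℕ} (σ : Equiv.Perm (Fin (n + 1))) {v : Fin (n + 2)}
    (hv : (σ (Fin.last n) : ℕ) < v) (hvn : v ≠ Fin.last (n + 1))
    (h : (v : ℕ) - ((σ (Fin.last n) : ℕ) + 1) ≤ runAbove σ) :
    runAbove (append σ v) = runAbove σ - ((v : ℕ) - ((σ (Fin.last n) : ℕ) + 1)) := by
  have hvn : (v : ℕ) < n + 1 := Fin.val_lt_last hvn
  rw [runAbove, le_upRun_iff (by omega), Nat.add_sub_cancel' hv] at h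
  have := upRun_add (p := IsLRMaxValue σ) (t := (σ (Fin.last n) : ℕ) + 1)
    ((v : ℕ) - ((σ (Fin.last n) : ℕ) + 1)) (n - v) fun c h1 h2 => h c h1 (by omega)
  rw [Nat.add_sub_cancel' hv,
    show (v : ℕ) - ((σ (Fin.last n) : ℕ) + 1) + (n - v) = n - ((σ (Fin.last n) : ℕ) + 1) by
      omega] at this
  rw [runAbove, append_last, upRun_congr (s := v) (q := IsLRMaxValue σ) fun c hc => by
    rw [add_right_comm (v : ℕ) 1 c]
    exact isLRMaxValue_append_gt σ v (by omega) (by omega), runAbove, this,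
    Nat.add_sub_cancel_left]
  congr 1
  omega

-- Growth rule after the maximum: `(a, b)` produces `(a - j, j)` for `j ≤ a` and `(j, b - j)` for `j
-- ≤ b`. The second family is absent when the last entry is the maximum, for a larger value would
-- move the maximum.
open Classical in
lemma sum_avT1_succ {M : Type*} [AddCommMonoid M] {n p : ℕ} (hp : p ≤ n + 1)
    (φ : ℕ → ℕ → ℕ → M) :
    (∑ σ : Equiv.Perm (Fin (n + 2)), if σ ∈ avT1 (n + 2) ∧ pos σ = p then
        φ (lmax σ) (runBelow σ) (runAbove σ) else 0) =
      ∑ σ : Equiv.Perm (Fin (n + 1)), if σ ∈ avT1 (n + 1) ∧ pos σ = p then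
        (∑ j ∈ Finset.range (runBelow σ + 1), φ (lmax σ) (runBelow σ - j) j) +
          (if σ (Fin.last n) = Fin.last n then 0 else
            ∑ j ∈ Finset.range (runAbove σ + 1), φ (lmax σ) j (runAbove σ - j))
        else 0 := by
  rw [sum_perm_succ]
  refine Finset.sum_congr rfl fun σ _ => ?_
  rw [Fin.sum_univ_castSucc, pos_append_last,
    if_neg (show ¬ (append σ (Fin.last (n + 1)) ∈ avT1 (n + 2) ∧ n + 1 + 1 = p) by omega), add_zero]
  have hne (v : Fin (n + 1)) : v.castSucc ≠ Fin.last (n + 1) := (Fin.castSucc_lt_last v).ne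
  simp only [pos_append_of_ne σ (hne _), lmax_append, if_neg (hne _), add_zero]
  by_cases hσ : σ ∈ avT1 (n + 1) ∧ pos σ = p
  · rw [if_pos hσ]
    set e : ℕ := (σ (Fin.last n) : ℕ) with he
    have hen : e ≤ n := Fin.is_le _
    obtain ⟨Φ, hΦ⟩ : ∃ Φ : ℕ → M, Φ = fun u => if u ≤ e then
            (if e - u < runBelow σ + 1 then φ (lmax σ) (runBelow σ - (e - u)) (e - u) else 0)
          else (if u - (e + 1) < runAbove σ + 1 then
            φ (lmax σ) (u - (e + 1)) (runAbove σ - (u - (e + 1))) else 0) := ⟨_, rfl⟩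
    have hterm (v : Fin (n + 1)) :
        (if append σ v.castSucc ∈ avT1 (n + 2) ∧ pos σ = p then
          φ (lmax σ) (runBelow (append σ v.castSucc)) (runAbove (append σ v.castSucc)) else 0) =
        Φ v := by
      simp only [hΦ]
      by_cases hv : (v : ℕ) ≤ e
      · simp only [append_mem_avT1_iff_of_le σ (v := v.castSucc) hv, hσ, true_and, and_true,
          if_pos hv, Nat.lt_succ_iff]
        refine if_ctx_congr Iff.rfl (fun h => ?_) fun _ => rfl
        rw [runBelow_append_of_le σ hv h, runAbove_append_of_le σ hv h]
        rfl
      · rw [not_le] at hv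
        simp only [append_mem_avT1_iff_of_gt σ (v := v.castSucc) hv (hne v), hσ, true_and,
          and_true, if_neg hv.not_ge, Nat.lt_succ_iff]
        refine if_ctx_congr Iff.rfl (fun h => ?_) fun _ => rfl
        rw [runBelow_append_of_gt σ hv (hne v) h, runAbove_append_of_gt σ hv (hne v) h]
        rfl
    -- The inserted values split at the last entry `e`: those up to `e` cut the lower run, the
    -- others cut the upper run.
    have hrange : Finset.range (n + 1) = Finset.range (e + 1 + (n - e)) := by
      congr 1
      omega
    rw [Finset.sum_congr rfl fun v _ => hterm v, Fin.sum_univ_eq_sum_range, hrange,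
      Finset.sum_range_add]
    simp only [hΦ]
    congr 1
    · rw [← sum_range_ite_lt _ (Nat.add_le_add_right (show runBelow σ ≤ e from downRun_le _ e) 1),
        ← Finset.sum_range_reflect]
      refine Finset.sum_congr rfl fun j hj => ?_
      rw [Finset.mem_range] at hj
      rw [if_pos (by omega), show e - (e + 1 - 1 - j) = j by omega]
    · split_ifs with hl
      · have : e = n := by rw [he, hl, Fin.val_last]
        simp [this]
      · have hlt : e < n := Fin.val_lt_last hl
        rw [← sum_range_ite_lt _ (show runAbove σ + 1 ≤ n - e by
          have : runAbove σ ≤ n - (e + 1) := upRun_le _ _ _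
          omega)]
        refine Finset.sum_congr rfl fun j hj => ?_
        rw [if_neg (by omega), Nat.add_sub_cancel_left]
  · rw [if_neg hσ]
    refine Finset.sum_eq_zero fun v _ => if_neg fun h => hσ ⟨?_, h.2⟩
    exact ((append_mem_avT1_iff_runs σ _).mp h.1).1

/-! ### The generating functions of the growth rules -/

lemma pos_eq_iff {n : ℕ} (σ : Equiv.Perm (Fin (n + 1))) :
    pos σ = n + 1 ↔ σ (Fin.last n) = Fin.last n := by
  have h : σ.symm (Fin.last n) = Fin.last n ↔ σ (Fin.last n) = Fin.last n := by
    rw [Equiv.symm_apply_eq, eq_comm]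
  rw [pos, Nat.add_right_cancel_iff, ← h, Fin.ext_iff, Fin.val_last]

open Classical in
lemma sum_avT1_pos_last {M : Type*} [AddCommMonoid M] (n : ℕ)
    (f : Equiv.Perm (Fin (n + 1)) → M) :
    (∑ σ, if σ ∈ avT1 (n + 1) ∧ pos σ = n + 1 then f σ else 0) =
      ∑ τ : Equiv.Perm (Fin n), if Avoids321 τ then f (append τ (Fin.last n)) else 0 := by
  rw [sum_perm_succ]
  refine Finset.sum_congr rfl fun τ _ => ?_
  rw [Fintype.sum_eq_single (Fin.last n)]
  · simp only [append_last_mem_avT1_iff, pos_append_last, and_true]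
  · intro v hv
    rw [if_neg]
    rw [pos_eq_iff, append_last]
    exact fun h => hv h.2

open Classical in
/-- The enumerator of the `321`-avoiding permutations of length `n` by `lmax` and `topRun`. -/
noncomputable def topRunPoly (n : ℕ) : Polynomial YW :=
  ∑ σ : Equiv.Perm (Fin n), if Avoids321 σ then
    Polynomial.C (w ^ lmax σ) * Polynomial.X ^ topRun σ else 0

open Classical in
/-- The enumerator of the permutations in `avT1 (n + 1)` with the maximum at position `p`, by
`lmax` and by the two runs next to the last entry. -/
noncomputable def runsPoly (n p : ℕ) : Polynomial YW :=
  ∑ σ : Equiv.Perm (Fin (n + 1)), if σ ∈ avT1 (n + 1) ∧ pos σ = p then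
    Polynomial.C (w ^ lmax σ) * (Polynomial.X ^ runBelow σ + Polynomial.X ^ runAbove σ) else 0

open Classical in
/-- The enumerator of the permutations in `avT1 (n + 1)` with the maximum at position `p`, by
`lmax`. -/
noncomputable def lmaxPoly (n p : ℕ) : YW :=
  ∑ σ : Equiv.Perm (Fin (n + 1)), if σ ∈ avT1 (n + 1) ∧ pos σ = p then w ^ lmax σ else 0

lemma topRunPoly_zero : topRunPoly 0 = 1 := by
  have h (σ : Equiv.Perm (Fin 0)) : Avoids321 σ := fun i => i.elim0
  simp [topRunPoly, h, topRun, downRun, lmax]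

lemma eval_one_topRunPoly (n : ℕ) [DecidablePred (Avoids321 (n := n))] :
    (topRunPoly n).eval 1 = ∑ σ : Equiv.Perm (Fin n), if Avoids321 σ then w ^ lmax σ else 0 := by
  rw [topRunPoly, Polynomial.eval_finsetSum]
  refine Finset.sum_congr rfl fun σ _ => ?_
  split_ifs <;> simp

lemma eval_one_runsPoly (n p : ℕ) : (runsPoly n p).eval 1 = 2 * lmaxPoly n p := by
  rw [runsPoly, lmaxPoly, Polynomial.eval_finsetSum, Finset.mul_sum]
  refine Finset.sum_congr rfl fun σ _ => ?_
  split_ifs <;> simp [mul_comm, one_add_one_eq_two]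

lemma topRunPoly_succ (n : ℕ) :
    (Polynomial.X - 1) * topRunPoly (n + 1) =
      Polynomial.C w * Polynomial.X * (Polynomial.X - 1) * topRunPoly n +
        Polynomial.X * (topRunPoly n - Polynomial.C ((topRunPoly n).eval 1)) := by
  classical
  rw [eval_one_topRunPoly, topRunPoly,
    sum_avoids321_succ n fun l r => Polynomial.C (w ^ l) * Polynomial.X ^ r, topRunPoly, map_sum,
    ← Finset.sum_sub_distrib, Finset.mul_sum, Finset.mul_sum, Finset.mul_sum,
    ← Finset.sum_add_distrib]
  refine Finset.sum_congr rfl fun σ _ => ?_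
  split_ifs
  · have hg := geom_sum_mul (Polynomial.X : Polynomial YW) (topRun σ)
    simp only [pow_succ, ← Finset.mul_sum, ← Finset.sum_mul, map_mul]
    linear_combination Polynomial.C (w ^ lmax σ) * Polynomial.X * hg
  · simp

lemma runBelow_append_last {n : ℕ} (σ : Equiv.Perm (Fin n)) :
    runBelow (append σ (Fin.last n)) = topRun σ := by
  rw [runBelow, append_last,
    downRun_congr fun c hc => isLRMaxValue_append_lt σ (Fin.last n) hc]
  rfl

lemma runsPoly_one (n : ℕ) :
    (Polynomial.X - 1) * runsPoly (n + 1) (n + 1) =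
      2 * Polynomial.C w *
        (Polynomial.X * topRunPoly n - Polynomial.C ((topRunPoly n).eval 1)) := by
  classical
  rw [eval_one_topRunPoly, runsPoly, sum_avT1_succ le_rfl fun l a b =>
    Polynomial.C (w ^ l) * (Polynomial.X ^ a + Polynomial.X ^ b), sum_avT1_pos_last, topRunPoly,
    map_sum, Finset.mul_sum, Finset.mul_sum, ← Finset.sum_sub_distrib, Finset.mul_sum]
  refine Finset.sum_congr rfl fun σ _ => ?_
  split_ifs with h1 h2
  · have hg := geom_sum_mul (Polynomial.X : Polynomial YW) (topRun σ + 1)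
    rw [add_zero, runBelow_append_last, lmax_append, if_pos rfl, ← Finset.mul_sum,
      Finset.sum_add_distrib, Finset.sum_flip fun j => (Polynomial.X : Polynomial YW) ^ j]
    rw [pow_succ, map_mul]
    linear_combination 2 * Polynomial.C (w ^ lmax σ) * Polynomial.C w * hg
  · exact absurd (append_last σ _) h2
  · simp

/-- Splitting a run of length `a` yields `∑ (X ^ (a - j) + X ^ j)`, twice a geometric sum in `X`. So
the symmetric weight `X ^ a + X ^ b` closes the recurrence with a single catalytic variable. -/
lemma runsPoly_succ {n p : ℕ} (hp : p ≤ n) :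
    (Polynomial.X - 1) * runsPoly (n + 1) p =
      2 * (Polynomial.X * runsPoly n p - Polynomial.C ((runsPoly n p).eval 1)) := by
  classical
  rw [eval_one_runsPoly, lmaxPoly, runsPoly, sum_avT1_succ (by omega) fun l a b =>
    Polynomial.C (w ^ l) * (Polynomial.X ^ a + Polynomial.X ^ b), runsPoly, map_mul,
    map_sum, Finset.mul_sum, Finset.mul_sum, Finset.mul_sum, ← Finset.sum_sub_distrib,
    Finset.mul_sum]
  refine Finset.sum_congr rfl fun σ _ => ?_
  split_ifs with h1 h2
  · have := (pos_eq_iff σ).mpr h2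
    omega
  · have ha := geom_sum_mul (Polynomial.X : Polynomial YW) (runBelow σ + 1)
    have hb := geom_sum_mul (Polynomial.X : Polynomial YW) (runAbove σ + 1)
    rw [← Finset.mul_sum, ← Finset.mul_sum, Finset.sum_add_distrib, Finset.sum_add_distrib,
      Finset.sum_flip fun j => (Polynomial.X : Polynomial YW) ^ j,
      Finset.sum_flip fun j => (Polynomial.X : Polynomial YW) ^ j, map_ofNat]
    linear_combination 2 * Polynomial.C (w ^ lmax σ) * (ha + hb)
  · simp

lemma lmaxPoly_last (n : ℕ) : lmaxPoly n (n + 1) = w * (topRunPoly n).eval 1 := by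
  classical
  rw [eval_one_topRunPoly, lmaxPoly, sum_avT1_pos_last, Finset.mul_sum]
  refine Finset.sum_congr rfl fun σ _ => ?_
  split_ifs
  · rw [lmax_append, if_pos rfl, pow_succ']
  · simp

/-! ### Solving the functional equations -/

/-- `N(x, w)`, with coefficients in `ℤ[y, w]`. -/
noncomputable def narayana : PowerSeries YW :=
  PowerSeries.map (Polynomial.aeval w).toRingHom N

lemma narayana_eq :
    narayana = 1 + PowerSeries.X * ((narayana - 1 + PowerSeries.C w) * narayana) := by
  have h := congrArg (PowerSeries.map (Polynomial.aeval (R := ℤ) w).toRingHom) N_eq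
  simpa [narayana] using h

/-- Extension of scalars to polynomials in a catalytic variable. -/
noncomputable abbrev liftC : PowerSeries YW →+* PowerSeries (Polynomial YW) :=
  PowerSeries.map Polynomial.C

/-- Specialisation of the catalytic variable at `1`. -/
noncomputable abbrev evalOne : PowerSeries (Polynomial YW) →+* PowerSeries YW :=
  PowerSeries.map (Polynomial.evalRingHom 1)

lemma liftC_narayana_eq : liftC narayana = 1 + PowerSeries.X *
    ((liftC narayana - 1 + PowerSeries.C (Polynomial.C w)) * liftC narayana) := by
  simpa using congrArg liftC narayana_eq

lemma evalOne_liftC (f : PowerSeries YW) : evalOne (liftC f) = f := by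
  ext1 n
  simp

/-- The catalytic variable as a constant power series. -/
noncomputable abbrev catVar : PowerSeries (Polynomial YW) := PowerSeries.C Polynomial.X

lemma catVar_sub_one_ne_zero : catVar - 1 ≠ 0 := by
  intro h
  have h2 : (Polynomial.X : Polynomial YW) - 1 = 0 := by
    simpa using congrArg PowerSeries.constantCoeff h
  exact (Polynomial.monic_X_sub_C (1 : YW)).ne_zero (by simpa using h2)

/-- The generating function of the polynomials `topRunPoly`. -/
noncomputable def topRunGF : PowerSeries (Polynomial YW) := PowerSeries.mk topRunPoly

lemma exists_kernel_solution : ∃ H : PowerSeries (Polynomial YW),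
    H * (1 - catVar *
      (PowerSeries.X * (liftC narayana - 1 + PowerSeries.C (Polynomial.C w)))) = 1 := by
  have : IsUnit (1 - catVar *
      (PowerSeries.X * (liftC narayana - 1 + PowerSeries.C (Polynomial.C w)))) := by
    rw [PowerSeries.isUnit_iff_constantCoeff]
    simp
  exact this.exists_left_inv

lemma evalOne_eq_narayana {H : PowerSeries (Polynomial YW)}
    (hH : H * (1 - catVar *
      (PowerSeries.X * (liftC narayana - 1 + PowerSeries.C (Polynomial.C w)))) = 1) :
    evalOne H = narayana := by
  have h1 := congrArg evalOne hH
  rw [map_mul, map_sub, map_mul, map_mul, map_add, map_sub, evalOne_liftC] at h1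
  simp only [map_one, PowerSeries.map_C, PowerSeries.map_X, Polynomial.coe_evalRingHom,
    Polynomial.eval_X, Polynomial.eval_C, one_mul] at h1
  linear_combination -evalOne H * narayana_eq + narayana * h1

/-- The kernel equation is solved by verification: the inverse `H` of the claimed denominator
satisfies it, and the equation determines all coefficients. -/
lemma topRunGF_mul :
    topRunGF *
      (1 - catVar *
        (PowerSeries.X * (liftC narayana - 1 + PowerSeries.C (Polynomial.C w)))) = 1 := by
  obtain ⟨H, hH⟩ := exists_kernel_solution
  have hev := evalOne_eq_narayana hH
  have hfun : (catVar - 1) * H = (catVar - 1) + PowerSeries.X *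
      (PowerSeries.C (Polynomial.C w * Polynomial.X * (Polynomial.X - 1)) * H) +
      PowerSeries.X * (PowerSeries.C Polynomial.X * (H - liftC (evalOne H))) := by
    have hreg : IsUnit (1 - catVar *
        (PowerSeries.X * (liftC narayana - 1 + PowerSeries.C (Polynomial.C w)))) :=
      .of_mul_eq_one_right _ hH
    apply hreg.mul_left_cancel
    rw [hev]
    simp only [map_mul, map_sub, map_one]
    linear_combination
      ((catVar - 1) - PowerSeries.X * PowerSeries.C (Polynomial.C w) * catVar * (catVar - 1) -
        PowerSeries.X * catVar) * hH + PowerSeries.X * catVar ^ 2 * liftC_narayana_eq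
  have hGH : topRunGF = H := by
    ext1 n
    rw [topRunGF, PowerSeries.coeff_mk]
    induction n with
    | zero =>
      have h0 := congrArg PowerSeries.constantCoeff hH
      simpa [topRunPoly_zero, eq_comm] using h0
    | succ n ih =>
      have hX : (Polynomial.X : Polynomial YW) - 1 ≠ 0 := by
        simpa using (Polynomial.monic_X_sub_C (1 : YW)).ne_zero
      -- The recurrence gives the next coefficient only after multiplication by `X - 1`, which is
      -- cancelled in the domain of polynomials.
      apply mul_left_cancel₀ hX
      have h1 := congrArg (PowerSeries.coeff (n + 1)) hfun
      rw [← map_one PowerSeries.C, ← map_sub, map_add, map_add, PowerSeries.coeff_succ_X_mul,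
        PowerSeries.coeff_succ_X_mul, PowerSeries.coeff_C_mul, PowerSeries.coeff_C_mul,
        PowerSeries.coeff_C_mul, PowerSeries.coeff_C, if_neg n.succ_ne_zero, zero_add, map_sub,
        PowerSeries.coeff_map, PowerSeries.coeff_map, ← ih] at h1
      rw [h1, topRunPoly_succ]
      rfl
  rw [hGH, hH]

lemma evalOne_topRunGF : evalOne topRunGF = narayana := evalOne_eq_narayana topRunGF_mul

/-- The effect of one summation over a run: the kernel quotient of `topRunGF`. -/
lemma catVar_mul_topRunGF_sub :
    catVar * topRunGF - liftC narayana = (catVar - 1) * (liftC narayana * topRunGF) := by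
  linear_combination (liftC narayana) * topRunGF_mul + (-catVar * topRunGF) * liftC_narayana_eq

/-- The generating function of the polynomials `runsPoly` with `m` entries after the maximum, by
the number of entries before the maximum. -/
noncomputable def runsGF (m : ℕ) : PowerSeries (Polynomial YW) :=
  PowerSeries.mk fun q => runsPoly (q + m) (q + 1)

/-- The generating function of the polynomials `lmaxPoly` with `m` entries after the maximum, by
the number of entries before the maximum. -/
noncomputable def lmaxGF (m : ℕ) : PowerSeries YW :=
  PowerSeries.mk fun q => lmaxPoly (q + m) (q + 1)

lemma evalOne_runsGF (m : ℕ) : evalOne (runsGF m) = 2 * lmaxGF m := by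
  ext1 q
  rw [← map_ofNat PowerSeries.C 2, PowerSeries.coeff_C_mul]
  simp [runsGF, lmaxGF, eval_one_runsPoly]

lemma runsGF_one :
    (catVar - 1) * runsGF 1 = 2 * PowerSeries.C (Polynomial.C w) *
      (catVar * topRunGF - liftC (evalOne topRunGF)) := by
  ext1 q
  rw [← map_one PowerSeries.C, ← map_sub, ← map_ofNat PowerSeries.C 2, ← map_mul,
    PowerSeries.coeff_C_mul, PowerSeries.coeff_C_mul, map_sub, PowerSeries.coeff_C_mul]
  simpa [runsGF, topRunGF] using runsPoly_one q

lemma runsGF_succ (m : ℕ) :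
    (catVar - 1) * runsGF (m + 2) =
      2 * (catVar * runsGF (m + 1) - liftC (evalOne (runsGF (m + 1)))) := by
  ext1 q
  rw [← map_one PowerSeries.C, ← map_sub, ← map_ofNat PowerSeries.C 2,
    PowerSeries.coeff_C_mul, PowerSeries.coeff_C_mul, map_sub, PowerSeries.coeff_C_mul]
  simp only [runsGF, PowerSeries.coeff_mk, PowerSeries.coeff_map, Polynomial.coe_evalRingHom]
  exact runsPoly_succ (show q + 1 ≤ q + (m + 1) by omega)

/-- The factor `N` is free of the catalytic variable, so by `catVar_mul_topRunGF_sub` each further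
entry multiplies by `2N`. -/
lemma runsGF_eq (m : ℕ) : runsGF (m + 1) =
    2 ^ (m + 1) * PowerSeries.C (Polynomial.C w) * liftC narayana ^ (m + 1) * topRunGF := by
  apply mul_left_cancel₀ catVar_sub_one_ne_zero
  induction m with
  | zero =>
    rw [runsGF_one, evalOne_topRunGF, catVar_mul_topRunGF_sub]
    ring
  | succ m ih =>
    have ih := mul_left_cancel₀ catVar_sub_one_ne_zero ih
    rw [runsGF_succ, ih]
    simp only [map_mul, map_pow, map_ofNat, evalOne_liftC, evalOne_topRunGF, PowerSeries.map_C,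
      Polynomial.coe_evalRingHom, Polynomial.eval_C]
    linear_combination (2 ^ (m + 2) * PowerSeries.C (Polynomial.C w) *
      liftC narayana ^ (m + 1)) * catVar_mul_topRunGF_sub

lemma lmaxGF_zero : lmaxGF 0 = PowerSeries.C w * narayana := by
  ext1 q
  rw [PowerSeries.coeff_C_mul, ← evalOne_topRunGF]
  simp [lmaxGF, topRunGF, lmaxPoly_last]

lemma lmaxGF_succ (m : ℕ) :
    lmaxGF (m + 1) = 2 ^ m * PowerSeries.C w * narayana ^ (m + 2) := by
  have h := congrArg evalOne (runsGF_eq m)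
  rw [evalOne_runsGF] at h
  simp only [map_mul, map_pow, map_ofNat, evalOne_liftC, evalOne_topRunGF, PowerSeries.map_C,
      Polynomial.coe_evalRingHom, Polynomial.eval_C] at h
  -- At `X = 1` each permutation is counted twice, once for each of its runs; this factor is
  -- cancelled.
  have h2 : (2 : PowerSeries YW) ≠ 0 := fun h => two_ne_zero (α := YW) <| by
    simpa only [map_ofNat, map_zero] using congrArg PowerSeries.constantCoeff h
  apply mul_left_cancel₀ h2
  rw [h]
  ring

/-! ### The generating functions `B` and `J` -/

open Classical in
lemma coeff_succ_statGF (A : ∀ n : ℕ, Set (Equiv.Perm (Fin (n + 1)))) (n : ℕ) :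
    PowerSeries.coeff (n + 1) (statGF A) =
      ∑ σ, if σ ∈ A n then y ^ pos σ * w ^ lmax σ else 0 := by
  rw [statGF, PowerSeries.coeff_mk]
  exact Finset.sum_filter _ _

lemma coeff_zero_statGF (A : ∀ n : ℕ, Set (Equiv.Perm (Fin (n + 1)))) :
    PowerSeries.coeff 0 (statGF A) = 0 := by
  rw [statGF, PowerSeries.coeff_mk]

lemma B_eq : B = PowerSeries.X * PowerSeries.C (y * w) * Nxyw := by
  classical
  ext1 n
  rw [mul_assoc]
  cases n with
  | zero => rw [PowerSeries.coeff_zero_X_mul, B, coeff_zero_statGF]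
  | succ n =>
    have h : lmaxPoly n (n + 1) = w * PowerSeries.coeff n narayana := by
      rw [lmaxPoly_last, ← evalOne_topRunGF]
      simp [topRunGF]
    rw [PowerSeries.coeff_succ_X_mul, PowerSeries.coeff_C_mul, B, coeff_succ_statGF, Nxyw,
      PowerSeries.coeff_rescale]
    have h2 : y * w * (y ^ n * PowerSeries.coeff n narayana) =
        y ^ (n + 1) * lmaxPoly n (n + 1) := by
      rw [h]
      ring
    refine Eq.trans ?_ h2.symm
    rw [lmaxPoly, Finset.mul_sum]
    refine Finset.sum_congr rfl fun σ _ => ?_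
    simp only [Set.mem_ofPred_eq, ← pos_eq_iff, mul_ite, mul_zero]
    refine if_ctx_congr Iff.rfl (fun h => ?_) fun _ => rfl
    rw [h.2]

lemma coeff_succ_J (n : ℕ) : PowerSeries.coeff (n + 1) J =
    ∑ m ∈ Finset.range (n + 1), y ^ (n - m + 1) * PowerSeries.coeff (n - m) (lmaxGF m) := by
  classical
  have h : PowerSeries.coeff (n + 1) J =
      ∑ q ∈ Finset.range (n + 1), y ^ (q + 1) * lmaxPoly n (q + 1) := by
    simp only [J, coeff_succ_statGF, lmaxPoly, Finset.mul_sum]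
    rw [Finset.sum_comm]
    refine Finset.sum_congr rfl fun σ _ => ?_
    by_cases hσ : σ ∈ avT1 (n + 1)
    · rw [Finset.sum_eq_single_of_mem (σ.symm (Fin.last n) : ℕ)
        (Finset.mem_range.mpr (Fin.is_lt _))]
      · simp [hσ, pos]
      · intro q _ hq
        rw [if_neg, mul_zero]
        rintro ⟨-, h⟩
        rw [pos] at h
        omega
    · simp [hσ]
  rw [h, ← Finset.sum_range_reflect]
  refine Finset.sum_congr rfl fun m hm => ?_
  rw [Finset.mem_range] at hm
  rw [lmaxGF, PowerSeries.coeff_mk, show n + 1 - 1 - m = n - m by omega,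
    show n - m + m = n by omega]

/-- The summand of `J` of the permutations with `m` entries after the maximum. -/
noncomputable def tailGF (m : ℕ) : PowerSeries YW :=
  PowerSeries.X ^ (m + 1) * PowerSeries.C y * PowerSeries.rescale y (lmaxGF m)

lemma X_pow_dvd_J_sub (M : ℕ) :
    (PowerSeries.X : PowerSeries YW) ^ M ∣ J - ∑ m ∈ Finset.range M, tailGF m := by
  rw [PowerSeries.X_pow_dvd_iff]
  intro k hk
  rw [map_sub, sub_eq_zero, map_sum]
  cases k with
  | zero =>
    rw [J, coeff_zero_statGF, Finset.sum_eq_zero]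
    intro m _
    simp [tailGF]
  | succ n =>
    rw [coeff_succ_J, ← sum_range_ite_lt _ (show n + 1 ≤ M by omega)]
    refine Finset.sum_congr rfl fun m _ => ?_
    rw [tailGF, mul_assoc, PowerSeries.coeff_X_pow_mul']
    refine if_ctx_congr (by omega) (fun h => ?_) fun _ => rfl
    rw [PowerSeries.coeff_C_mul, PowerSeries.coeff_rescale, Nat.add_sub_add_right]
    ring

/-- A telescoping geometric sum of ratio `2u`, `u = x N(xy, w)`, with its explicit remainder. The
term `m = 0` is exceptional: it is `yw u`, outside the progression. -/
lemma sum_tailGF (M : ℕ) :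
    (1 - 2 * (PowerSeries.X * Nxyw)) * ∑ m ∈ Finset.range (M + 1), tailGF m =
      PowerSeries.C (y * w) * (PowerSeries.X * Nxyw - (PowerSeries.X * Nxyw) ^ 2 -
        2 ^ M * (PowerSeries.X * Nxyw) ^ (M + 2)) := by
  have hN : PowerSeries.rescale y narayana = Nxyw := rfl
  have hC (a : YW) : PowerSeries.rescale y (PowerSeries.C a) = PowerSeries.C a := by
    ext1 n
    rw [PowerSeries.coeff_rescale, PowerSeries.coeff_C]
    split_ifs with h
    · simp [h]
    · simp
  induction M with
  | zero =>
    rw [Finset.sum_range_one, tailGF, lmaxGF_zero, map_mul, hN, hC, map_mul]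
    ring
  | succ M ih =>
    rw [Finset.sum_range_succ, mul_add, ih, tailGF, lmaxGF_succ]
    simp only [map_mul, map_pow, map_ofNat, hN, hC]
    ring

lemma one_sub_mul_J :
    (1 - 2 * (PowerSeries.X * Nxyw)) * J =
      PowerSeries.C (y * w) * (PowerSeries.X * Nxyw - (PowerSeries.X * Nxyw) ^ 2) := by
  rw [← sub_eq_zero]
  ext1 n
  -- Truncation replaces the infinite sum: modulo `x ^ (n + 1)` the remainder vanishes, which
  -- decides the coefficient of `x ^ n`.
  obtain ⟨r, hr⟩ := X_pow_dvd_J_sub (n + 1)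
  have hdvd : (PowerSeries.X : PowerSeries YW) ^ (n + 1) ∣
      (1 - 2 * (PowerSeries.X * Nxyw)) * J -
        PowerSeries.C (y * w) * (PowerSeries.X * Nxyw - (PowerSeries.X * Nxyw) ^ 2) :=
    ⟨(1 - 2 * (PowerSeries.X * Nxyw)) * r -
      PowerSeries.C (y * w) * 2 ^ n * PowerSeries.X * Nxyw ^ (n + 2), by
      linear_combination (1 - 2 * (PowerSeries.X * Nxyw)) * hr + sum_tailGF n⟩
  rw [PowerSeries.X_pow_dvd_iff.mp hdvd n n.lt_succ_self, map_zero]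

end PermClass

open PermClass in
/-- `J = B (B - yw) / (2B - yw)`, where `B = xyw N(xy, w)` and
`N(x, z) = 1 + (1 - x(1 + z) - √((1 - x(1 + z))² - 4x²z)) / (2x)`. The quotients are taken in the
fraction fields of `ℤ[y, w]⟦x⟧` and `ℤ[z]⟦x⟧`. -/
theorem theorem10 :
    2 * B - PowerSeries.C (y * w) ≠ 0 ∧
    algebraMap (PowerSeries YW) (FractionRing (PowerSeries YW)) J =
      algebraMap (PowerSeries YW) (FractionRing (PowerSeries YW))
          (B * (B - PowerSeries.C (y * w))) /
        algebraMap (PowerSeries YW) (FractionRing (PowerSeries YW))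
          (2 * B - PowerSeries.C (y * w)) ∧
    B = PowerSeries.X * PowerSeries.C (y * w) * Nxyw ∧
    ∃ S : PowerSeries (Polynomial ℤ),
      IsSqrt S
        ((1 - PowerSeries.X * (1 + PowerSeries.C Polynomial.X)) ^ 2 -
          4 * PowerSeries.X ^ 2 * PowerSeries.C Polynomial.X) ∧
      algebraMap (PowerSeries (Polynomial ℤ)) (FractionRing (PowerSeries (Polynomial ℤ))) N =
        1 + algebraMap (PowerSeries (Polynomial ℤ)) (FractionRing (PowerSeries (Polynomial ℤ)))
              (1 - PowerSeries.X * (1 + PowerSeries.C Polynomial.X) - S) /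
            algebraMap (PowerSeries (Polynomial ℤ)) (FractionRing (PowerSeries (Polynomial ℤ)))
              (2 * PowerSeries.X) := by
  have hne : 2 * B - PowerSeries.C (y * w) ≠ 0 := by
    intro h
    have h0 := congrArg PowerSeries.constantCoeff h
    -- `B` has no constant term, so the constant term of the denominator is `-yw`.
    simp [B_eq, y, w, MvPolynomial.X_ne_zero] at h0
  have hne' := (map_ne_zero_iff (algebraMap (PowerSeries YW) (FractionRing (PowerSeries YW)))
    (IsFractionRing.injective _ _)).mpr hne
  refine ⟨hne, ?_, B_eq, exists_isSqrt_N⟩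
  rw [eq_div_iff hne', ← map_mul]
  congr 1
  rw [B_eq]
  linear_combination (-PowerSeries.C (y * w)) * one_sub_mul_J
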